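/- Let $A$ be a finite nonempty alphabet of size $m=|A|$, let $U$ be the uniform p.m.f. on $A$, and let $\log$ denote the logarithm to base $2$. For p.m.f.s $P,Q$ on $A$ let $D_{1/2}(P\|Q)=-2\log\sum_{x\in A}\sqrt{P(x)Q(x)}$, and for $\delta>0$ let $\mathcal Q_\delta=\{P: P\text{ is a p.m.f. on }A,\ D_{1/2}(P\|U)\ge\delta\}$. For a family $\mathcal Q$ of p.m.f.s on $A$ and $\epsilon\in(0,1)$ define the universal fixed-length sample complexity $$n^{\sf fl}(\mathcal Q,\epsilon)=\inf\Big\{n\ge 1:\ \inf_{C_n\subset A^n}\max\Big\{\sup_{P\in\mathcal Q}P^n(C_n^c),\ \frac{|C_n|}{m^n}\Big\}\le\epsilon\Big\},$$ where $P^n$ is the product p.m.f. on $A^n$ (and the supremum over an empty family is $0$). (i) For every $\epsilon_0<\tfrac12$ there is a constant $C_1>0$, depending only on $\epsilon_0$ (not on $A$, $m$, $\epsilon$, $\delta$), such that for all $A$, all $\epsilon\in(0,\epsilon_0]$ and all $\delta\in(0,\log e)$ with $\delta<\log m$, $$n^{\sf fl}(\mathcal Q_\delta,\epsilon)\ \ge\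 C_1\,\frac{\log(1/\epsilon)+\sqrt{m\log(1/\epsilon)}}{\delta}.$$ (ii) There is an absolute constant $C_2>0$ such that for all $A$, all $\epsilon\in(0,1)$ and all $\delta\in(0,1)$, $$n^{\sf fl}(\mathcal Q_\delta,\epsilon)\ \le\ C_2\,\frac{\sqrt m\,\big[\log(1/\epsilon)+\tfrac1{18}\big]}{\delta}.$$ -/

import Mathlib

/-- The simplex of all probability mass functions on the finite alphabet `A`. -/
abbrev Simplex (A : Type*) [Fintype A] : Type _ := stdSimplex ℝ A

/-- The uniform p.m.f. on a nonempty finite alphabet. -/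
noncomputable def uniformPmf (A : Type*) [Fintype A] [Nonempty A] : Simplex A :=
  ⟨fun _ => 1 / (Fintype.card A : ℝ), fun _ => by positivity, by simp⟩

/-- The Rényi divergence of order `1/2` between two p.m.f.s, in bits:
`D_{1/2}(P‖Q) = -2 log₂ ∑ₓ √(P(x) Q(x))`. (It is used below only for `Q` uniform, where the sum
is strictly positive.) -/
noncomputable def renyiHalf {A : Type*} [Fintype A] (P Q : Simplex A) : ℝ :=
  -2 * Real.logb 2 (∑ x, Real.sqrt (P.1 x * Q.1 x))

/-- The probability `Pⁿ(C) = ∑_{x ∈ C} ∏ᵢ P(xᵢ)` that the first `n` symbols of the memoryless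
source with marginal `P` fall in `C ⊆ Aⁿ`. -/
noncomputable def blockProb {A : Type*} [Fintype A] (P : Simplex A) {n : ℕ}
    (C : Finset (Fin n → A)) : ℝ :=
  ∑ x ∈ C, ∏ i, P.1 (x i)

/-- The best worst-case performance of a codebook at blocklength `n` on the family `Q`:
`inf_{C ⊆ Aⁿ} max { sup_{P ∈ Q} Pⁿ(Cᶜ), |C| / |A|ⁿ }`. The supremum over an empty family is `0`. -/
noncomputable def bestCodebookValue {A : Type*} [Fintype A] [DecidableEq A]
    (Q : Set (Simplex A)) (n : ℕ) : ℝ :=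
  ⨅ C : Finset (Fin n → A),
    max (⨆ P : Q, blockProb P.1 Cᶜ) ((C.card : ℝ) / (Fintype.card A : ℝ) ^ n)

/-- The universal fixed-length sample complexity `n^fl(Q, ε)` of the family of memoryless sources
with marginals in `Q`: the infimum of the blocklengths `n ≥ 1` at which the best codebook value is
at most `ε` (`⊤` if there is no such blocklength). -/
noncomputable def flSampleComplexity {A : Type*} [Fintype A] [DecidableEq A]
    (Q : Set (Simplex A)) (ε : ℝ) : ℕ∞ :=
  sInf {N : ℕ∞ | ∃ n : ℕ, N = n ∧ 1 ≤ n ∧ bestCodebookValue Q n ≤ ε}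

/-- The family `Q_δ = {P : D_{1/2}(P‖U) ≥ δ}`, with `U` uniform on `A`. -/
def renyiFamily (A : Type*) [Fintype A] [Nonempty A] (δ : ℝ) : Set (Simplex A) :=
  {P | δ ≤ renyiHalf P (uniformPmf A)}

/-!
Both bounds are about testing the uniform distribution on `m` symbols against all sources at Rényi
divergence at least `δ` from it: a codebook is the acceptance region of the alternative, and its
two costs are the two error probabilities of the test.

*Lower bound.* A codebook that is good for the whole family is good for every mixture of its
members. The alphabet is split into blocks of bounded size (`exists_blocks`), and one symbol is
selected in each block; the member attached to the selection moves a fraction `γ` of the mass of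
each block to the selected symbol. By the intermediate value theorem `γ` can be chosen so that the
divergence is exactly `δ`, and then `γ² ≤ 8 δ` (`exists_spike_height`). Blocks of size at least
three are what allows `δ` to go up to `log e < log 3`. For two selections `s`, `t` the correlation
`m ∑ P_s P_t` is `1` plus a sum over the blocks, of independent and centred terms for random `s`;
so the mixture of the `n`-fold products has second moment, relative to the uniform distribution, at
most the exponential of `5 n γ²` and also of `216 n² γ⁴ / m`
(`sum_correlation_pow_le_linear`, `sum_correlation_pow_le_quadratic`). By Cauchy-Schwarz both
exponents are at least of order `log (1/ε)` (`sq_le_of_mixture`, `mul_log_le_of_sq_le`), which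
yields the two terms of the bound.

*Upper bound.* The number of coincidences between two halves of a block of symbols has, after
centring, a mean proportional to the chi-square divergence of the source from uniform, and that is
at least `δ / 4` on the family (`chiSqUniform_ge_of_mem`). A variance computation and Chebyshev's
inequality show that order `√m / δ` symbols make both errors a small constant
(`exists_collision_test`). Repeating the test on order `log (1/ε)` disjoint blocks and applying
Markov's inequality to a product brings both errors below `ε` (`bestCodebookValue_le_of_test`).
-/

/-! ### Expectations over memoryless blocks -/

/-- The expectation of `f` over a block of independent symbols, indexed by a finite type `ι`, each
with weights `p`. Neither nonnegativity nor total mass one of `p` is built in. -/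
noncomputable def iidMean {A ι : Type*} [Fintype A] [Fintype ι] [DecidableEq ι]
    (p : A → ℝ) (f : (ι → A) → ℝ) : ℝ :=
  ∑ x, (∏ i, p (x i)) * f x

section IidMean

variable {A ι κ : Type*} [Fintype A] [Fintype ι] [DecidableEq ι] [Fintype κ] [DecidableEq κ]
  {p : A → ℝ}

lemma iidMean_prod (p : A → ℝ) (f : ι → A → ℝ) :
    iidMean p (fun x => ∏ i, f i (x i)) = ∏ i, ∑ a, p a * f i a := by
  rw [Finset.prod_univ_sum, Fintype.piFinset_univ]
  simp [iidMean, Finset.prod_mul_distrib]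

lemma iidMean_add (p : A → ℝ) (f g : (ι → A) → ℝ) :
    iidMean p (fun x => f x + g x) = iidMean p f + iidMean p g := by
  simp [iidMean, mul_add, Finset.sum_add_distrib]

lemma iidMean_mul_left (p : A → ℝ) (c : ℝ) (f : (ι → A) → ℝ) :
    iidMean p (fun x => c * f x) = c * iidMean p f := by
  simp only [iidMean, Finset.mul_sum]
  exact Finset.sum_congr rfl fun x _ => by ring

lemma iidMean_sum {α : Type*} (s : Finset α) (p : A → ℝ) (f : α → (ι → A) → ℝ) :
    iidMean p (fun x => ∑ a ∈ s, f a x) = ∑ a ∈ s, iidMean p (f a) := by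
  simp only [iidMean, Finset.mul_sum]
  exact Finset.sum_comm

lemma iidMean_mono (hp : ∀ a, 0 ≤ p a) {f g : (ι → A) → ℝ} (h : ∀ x, f x ≤ g x) :
    iidMean p f ≤ iidMean p g :=
  Finset.sum_le_sum fun x _ =>
    mul_le_mul_of_nonneg_left (h x) (Finset.prod_nonneg fun i _ => hp (x i))

lemma iidMean_const (hp : ∑ a, p a = 1) (c : ℝ) :
    iidMean p (fun _ : ι → A => c) = c := by
  have h := iidMean_prod p (fun (_ : ι) (_ : A) => (1 : ℝ))
  simp only [Finset.prod_const_one, mul_one, hp] at h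
  simpa [h] using iidMean_mul_left p c (fun _ : ι → A => (1 : ℝ))

lemma iidMean_apply (hp : ∑ a, p a = 1) (g : A → ℝ) (i : ι) :
    iidMean p (fun x => g (x i)) = ∑ a, p a * g a := by
  have h := iidMean_prod p (fun (k : ι) (a : A) => if k = i then g a else 1)
  simpa [Finset.prod_ite_eq', mul_ite, hp, Finset.sum_ite_irrel] using h

lemma iidMean_mul_apply (hp : ∑ a, p a = 1) (g h : A → ℝ) {i j : ι} (hij : i ≠ j) :
    iidMean p (fun x => g (x i) * h (x j)) = (∑ a, p a * g a) * ∑ a, p a * h a := by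
  have key := iidMean_prod p
    (fun (k : ι) (a : A) => (if k = i then g a else 1) * (if k = j then h a else 1))
  have hk : ∀ k : ι, ∑ a, p a * ((if k = i then g a else 1) * (if k = j then h a else 1))
      = (if k = i then ∑ a, p a * g a else 1) * (if k = j then ∑ a, p a * h a else 1) := by
    intro k
    by_cases h1 : k = i
    · have h2 : k ≠ j := fun h2 => hij (h1.symm.trans h2)
      simp [h1, hij]
    · by_cases h2 : k = j
      · simp [h2, hij.symm]
      · simp [h1, h2, hp]
  simp only [hk, Finset.prod_mul_distrib] at key
  simpa using key

/-- The second moment of a sum of independent identically distributed terms. -/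
lemma iidMean_sum_sq (hp : ∑ a, p a = 1) (g : A → ℝ) :
    iidMean p (fun x : ι → A => (∑ i, g (x i)) ^ 2) =
      Fintype.card ι * ∑ a, p a * g a ^ 2 +
        (Fintype.card ι * (Fintype.card ι - 1) : ℝ) * (∑ a, p a * g a) ^ 2 := by
  have h1 : ∀ i j : ι, iidMean p (fun x => g (x i) * g (x j)) =
      (∑ a, p a * g a) ^ 2 +
        if i = j then ∑ a, p a * g a ^ 2 - (∑ a, p a * g a) ^ 2 else 0 := by
    intro i j
    by_cases hij : i = j
    · subst hij
      have := iidMean_apply hp (fun a => g a ^ 2) i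
      simp only [pow_two] at this ⊢
      simp [this]
    · rw [iidMean_mul_apply hp g g hij]
      simp [hij, pow_two]
  simp only [pow_two (∑ i, g _), Finset.sum_mul_sum, iidMean_sum, h1, Finset.sum_add_distrib]
  simp
  ring

/-- Permuting or renaming the positions of a block does not change the expectation. -/
lemma iidMean_reindex (p : A → ℝ) (e : ι ≃ κ) (f : (κ → A) → ℝ) :
    iidMean p (fun x : ι → A => f (x ∘ e.symm)) = iidMean p f := by
  unfold iidMean
  refine Fintype.sum_equiv (e.arrowCongr (Equiv.refl A)) _ _ fun x => ?_
  have h : (e.arrowCongr (Equiv.refl A)) x = x ∘ e.symm := rfl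
  rw [h]
  congr 1
  exact (Equiv.prod_comp e.symm fun i => p (x i)).symm

lemma iidMean_sumElim (p : A → ℝ) (f : (ι ⊕ κ → A) → ℝ) :
    iidMean p f = iidMean p fun x : ι → A => iidMean p fun y : κ → A => f (Sum.elim x y) := by
  unfold iidMean
  rw [← (Equiv.sumArrowEquivProdArrow ι κ A).symm.sum_comp, Fintype.sum_prod_type]
  refine Finset.sum_congr rfl fun x _ => ?_
  rw [Finset.mul_sum]
  refine Finset.sum_congr rfl fun y _ => ?_
  simp [Equiv.sumArrowEquivProdArrow, Fintype.prod_sum_type, mul_assoc]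

/-- On disjoint blocks the expectation is multiplicative. -/
lemma iidMean_prod_blocks (p : A → ℝ) (f : (κ → A) → ℝ) :
    iidMean p (fun x : ι × κ → A => ∏ i, f fun j => x (i, j)) =
      iidMean p f ^ Fintype.card ι := by
  have h := iidMean_prod (ι := ι) (fun y : κ → A => ∏ j, p (y j)) (fun _ => f)
  rw [Finset.prod_const, Finset.card_univ] at h
  rw [show iidMean p f = ∑ y : κ → A, (∏ j, p (y j)) * f y from rfl, ← h]
  unfold iidMean
  refine Fintype.sum_equiv (Equiv.curry ι κ A) _ _ fun x => ?_
  simp only [Equiv.curry_apply, Fintype.prod_prod_type, Function.curry_apply]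
  rfl

end IidMean

lemma blockProb_eq_iidMean {A : Type*} [Fintype A] [DecidableEq A] (P : Simplex A) {n : ℕ}
    (C : Finset (Fin n → A)) :
    blockProb P C = iidMean P.1 fun x => if x ∈ C then 1 else 0 := by
  simp [blockProb, iidMean, Finset.sum_ite_mem]

lemma card_div_eq_iidMean {A : Type*} [Fintype A] [DecidableEq A] {n : ℕ}
    (C : Finset (Fin n → A)) :
    (C.card : ℝ) / (Fintype.card A : ℝ) ^ n =
      iidMean (fun _ => 1 / (Fintype.card A : ℝ)) fun x => if x ∈ C then 1 else 0 := by
  simp [iidMean, Finset.sum_ite_mem, div_eq_mul_inv]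

/-! ### Amplifying a test of constant quality -/

/-- If a positive function `f` of `l` symbols has expectation at most `1/2` under the uniform
distribution, and `1 / f` has expectation at most `1/2` under each source of the family, then
accepting when the product of `f` over `k` disjoint blocks is at least `1` has both errors at most
`2⁻ᵏ`: this is Markov's inequality for the product and for its inverse. -/
lemma bestCodebookValue_le_of_test {A κ : Type*} [Fintype A] [DecidableEq A] [Fintype κ]
    [DecidableEq κ] (Q : Set (Simplex A)) (f : (κ → A) → ℝ) (hf : ∀ y, 0 < f y)
    (hU : iidMean (fun _ => 1 / (Fintype.card A : ℝ)) f ≤ 1 / 2)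
    (hQ : ∀ P ∈ Q, iidMean P.1 (fun y => (f y)⁻¹) ≤ 1 / 2) (k : ℕ) :
    bestCodebookValue Q (k * Fintype.card κ) ≤ (1 / 2) ^ k := by
  obtain ⟨e⟩ : Nonempty (Fin (k * Fintype.card κ) ≃ Fin k × κ) :=
    ⟨Fintype.equivOfCardEq (by simp)⟩
  set G : (Fin (k * Fintype.card κ) → A) → ℝ :=
    fun x => ∏ i, f fun j => (x ∘ e.symm) (i, j) with hG
  have hGpos : ∀ x, 0 < G x := fun x => Finset.prod_pos fun i _ => hf _
  have hmean : ∀ (p : A → ℝ) (g : (κ → A) → ℝ), (∀ a, 0 ≤ p a) → (∀ y, 0 < g y) →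
      iidMean p g ≤ 1 / 2 → iidMean p (fun x : Fin (k * Fintype.card κ) → A =>
        ∏ i, g fun j => (x ∘ e.symm) (i, j)) ≤ (1 / 2) ^ k := by
    intro p g hp hg h
    rw [iidMean_reindex p e (fun x : Fin k × κ → A => ∏ i, g fun j => x (i, j)),
      iidMean_prod_blocks, Fintype.card_fin]
    refine pow_le_pow_left₀ ?_ h k
    exact Finset.sum_nonneg fun x _ =>
      mul_nonneg (Finset.prod_nonneg fun i _ => hp _) (hg x).le
  refine (ciInf_le (Set.finite_range _).bddBelow (Finset.univ.filter fun x => 1 ≤ G x)).trans ?_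
  refine max_le (Real.iSup_le (fun P => ?_) (by positivity)) ?_
  · rw [blockProb_eq_iidMean]
    refine le_trans (iidMean_mono P.1.2.1 fun x => ?_)
      (hmean P.1.1 (fun y => (f y)⁻¹) P.1.2.1 (fun y => inv_pos.2 (hf y)) (hQ P.1 P.2))
    rw [Finset.prod_inv_distrib]
    change _ ≤ (G x)⁻¹
    by_cases h : 1 ≤ G x
    · simp [not_lt.2 h, (hGpos x).le]
    · simpa [not_le.1 h] using (one_le_inv₀ (hGpos x)).2 (not_le.1 h).le
  · rw [card_div_eq_iidMean]
    refine le_trans (iidMean_mono (fun _ => by positivity) fun x => ?_)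
      (hmean _ f (fun _ => by positivity) hf hU)
    change _ ≤ G x
    by_cases h : 1 ≤ G x
    · simp [h]
    · simp [h, (hGpos x).le]

/-! ### The collision test -/

section Collision

variable {A : Type*} [Fintype A]

/-- The chi-square divergence `m ∑ p² - 1` of `p` from the uniform distribution. -/
noncomputable def chiSqUniform (p : A → ℝ) : ℝ :=
  Fintype.card A * ∑ a, p a ^ 2 - 1

/-- The centred collision kernel `m 1{a = b} - 1`; its mean over two independent symbols with
weights `p` is `chiSqUniform p`. -/
noncomputable def collisionKernel [DecidableEq A] (a b : A) : ℝ :=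
  (if a = b then (Fintype.card A : ℝ) else 0) - 1

/-- The number of coincidences between the two halves of a block, centred and scaled. -/
noncomputable def collisionStat [DecidableEq A] (n : ℕ) (z : Fin n ⊕ Fin n → A) : ℝ :=
  ∑ i, ∑ j, collisionKernel (z (Sum.inl i)) (z (Sum.inr j))

lemma sum_card_mul_sub_one_sq {p : A → ℝ} (hp : ∑ a, p a = 1) :
    ∑ a, (Fintype.card A * p a - 1) ^ 2 = Fintype.card A * chiSqUniform p := by
  have : ∀ a, (Fintype.card A * p a - 1) ^ 2 =
      (Fintype.card A : ℝ) ^ 2 * p a ^ 2 - 2 * Fintype.card A * p a + 1 := fun a => by ring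
  simp only [this, Finset.sum_add_distrib, Finset.sum_sub_distrib, ← Finset.mul_sum, hp,
    chiSqUniform]
  simp
  ring

lemma sum_mul_card_mul_sub_one {p : A → ℝ} (hp : ∑ a, p a = 1) :
    ∑ a, p a * (Fintype.card A * p a - 1) = chiSqUniform p := by
  simp only [chiSqUniform, mul_sub, Finset.sum_sub_distrib, mul_one, hp, Finset.mul_sum]
  congr 1
  exact Finset.sum_congr rfl fun a _ => by ring

lemma sum_mul_sq_le_chiSqUniform [Nonempty A] {p : A → ℝ} (hp : ∑ a, p a = 1) :
    ∑ a, p a * (Fintype.card A * p a - 1) ^ 2 ≤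
      (1 + √(Fintype.card A * chiSqUniform p)) * chiSqUniform p := by
  have hm : (0 : ℝ) < Fintype.card A := by exact_mod_cast Fintype.card_pos
  have hsum := sum_card_mul_sub_one_sq hp
  have hle : ∀ a, p a ≤ (1 + √(Fintype.card A * chiSqUniform p)) / Fintype.card A := by
    intro a
    rw [le_div_iff₀ hm, ← hsum]
    have := Real.le_sqrt_of_sq_le (Finset.single_le_sum
      (f := fun a => (Fintype.card A * p a - 1) ^ 2) (fun i _ => sq_nonneg _) (Finset.mem_univ a))
    linarith
  calc ∑ a, p a * (Fintype.card A * p a - 1) ^ 2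
      ≤ ∑ a, (1 + √(Fintype.card A * chiSqUniform p)) / Fintype.card A *
          (Fintype.card A * p a - 1) ^ 2 :=
        Finset.sum_le_sum fun a _ => mul_le_mul_of_nonneg_right (hle a) (sq_nonneg _)
    _ = _ := by
        rw [← Finset.mul_sum, hsum]
        field_simp

/-- Closeness in the Bhattacharyya coefficient is controlled by the chi-square divergence; this
averages the pointwise bound `√t ≥ 1 + (t - 1) / 2 - (t - 1) ^ 2 / 2` at `t = m p(a)`. -/
lemma one_sub_bhattacharyya_le [Nonempty A] {p : A → ℝ} (hp0 : ∀ a, 0 ≤ p a)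
    (hp : ∑ a, p a = 1) :
    1 - ∑ a, √(p a * (1 / Fintype.card A)) ≤ chiSqUniform p / 2 := by
  have hm : (0 : ℝ) < Fintype.card A := by exact_mod_cast Fintype.card_pos
  have hpt : ∀ t : ℝ, 0 ≤ t → 1 + (t - 1) / 2 - (t - 1) ^ 2 / 2 ≤ √t := by
    intro t ht
    obtain ⟨s, hs, rfl⟩ : ∃ s : ℝ, 0 ≤ s ∧ t = s ^ 2 := ⟨√t, by positivity, (Real.sq_sqrt ht).symm⟩
    rw [Real.sqrt_sq hs]
    nlinarith [mul_nonneg (sq_nonneg (s - 1)) (mul_nonneg hs (by linarith : (0 : ℝ) ≤ s + 2))]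
  have hterm : ∀ a, √(p a * (1 / Fintype.card A)) =
      √(Fintype.card A * p a) / Fintype.card A := by
    intro a
    rw [show p a * (1 / (Fintype.card A : ℝ)) =
      Fintype.card A * p a / (Fintype.card A : ℝ) ^ 2 by field_simp, Real.sqrt_div' _ (sq_nonneg _),
      Real.sqrt_sq hm.le]
  have hsum : ∑ a, (1 + ((Fintype.card A : ℝ) * p a - 1) / 2 -
      ((Fintype.card A : ℝ) * p a - 1) ^ 2 / 2) =
      Fintype.card A - Fintype.card A * chiSqUniform p / 2 := by
    have h := sum_card_mul_sub_one_sq hp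
    simp only [Finset.sum_add_distrib, Finset.sum_sub_distrib, ← Finset.sum_div, h,
      ← Finset.mul_sum, hp]
    simp
  have hle := Finset.sum_le_sum fun a (_ : a ∈ Finset.univ) =>
    hpt ((Fintype.card A : ℝ) * p a) (mul_nonneg hm.le (hp0 a))
  rw [hsum] at hle
  simp only [hterm, ← Finset.sum_div]
  rw [sub_le_iff_le_add, ← sub_le_iff_le_add', le_div_iff₀ hm]
  linarith

lemma chiSqUniform_ge_of_mem [Nonempty A] {δ : ℝ} (h0 : 0 < δ) (h1 : δ < 1) {P : Simplex A}
    (hP : P ∈ renyiFamily A δ) : δ / 4 ≤ chiSqUniform P.1 := by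
  have hB := one_sub_bhattacharyya_le P.2.1 P.2.2
  have hD : δ ≤ -2 * Real.logb 2 (∑ a, √(P.1 a * (1 / Fintype.card A))) := hP
  set B := ∑ a, √(P.1 a * (1 / (Fintype.card A : ℝ)))
  have hB0 : 0 ≤ B := Finset.sum_nonneg fun a _ => Real.sqrt_nonneg _
  rcases hB0.eq_or_lt with h | hpos
  · linarith
  have hl2 : 1 / 2 < Real.log 2 := by linarith [Real.log_two_gt_d9]
  have hl2' : Real.log 2 < 1 := by linarith [Real.log_two_lt_d9]
  have hlog : Real.log B ≤ -(δ * Real.log 2 / 2) := by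
    rw [Real.logb, ← mul_div_assoc, le_div_iff₀ (by linarith)] at hD
    linarith
  have hBle : B ≤ Real.exp (-(δ * Real.log 2 / 2)) := (Real.log_le_iff_le_exp hpos).1 hlog
  -- `exp (-y) ≤ 1 - y / 2` for `0 ≤ y ≤ 1`, from `exp (-y) ≤ 1 / (1 + y)`.
  have hy : ∀ y : ℝ, 0 ≤ y → y ≤ 1 → Real.exp (-y) ≤ 1 - y / 2 := by
    intro y hy0 hy1
    rw [Real.exp_neg, inv_le_comm₀ (Real.exp_pos y) (by linarith)]
    refine le_trans ?_ (Real.add_one_le_exp y)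
    rw [inv_le_iff_one_le_mul₀ (by linarith)]
    nlinarith
  have := hy (δ * Real.log 2 / 2) (by positivity) (by nlinarith)
  nlinarith

variable [DecidableEq A]

lemma collisionKernel_mean_right {p : A → ℝ} (hp : ∑ a, p a = 1) (a : A) :
    ∑ b, p b * collisionKernel a b = Fintype.card A * p a - 1 := by
  simp [collisionKernel, mul_sub, Finset.sum_sub_distrib, hp, mul_comm]

lemma collisionKernel_comm (a b : A) : collisionKernel a b = collisionKernel b a := by
  simp [collisionKernel, eq_comm]

lemma collisionKernel_second_moment {p : A → ℝ} (hp : ∑ a, p a = 1) :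
    ∑ a, p a * ∑ b, p b * collisionKernel b a ^ 2 =
      (Fintype.card A : ℝ) * (1 + chiSqUniform p) - 2 * (1 + chiSqUniform p) + 1 := by
  have h : ∀ a b : A, p b * collisionKernel b a ^ 2 =
      (if b = a then p b * ((Fintype.card A : ℝ) ^ 2 - 2 * Fintype.card A) else 0) + p b := by
    intro a b
    unfold collisionKernel
    split_ifs <;> ring
  have h2 : ∀ a, p a * ∑ b, p b * collisionKernel b a ^ 2 =
      ((Fintype.card A : ℝ) ^ 2 - 2 * Fintype.card A) * p a ^ 2 + p a := by
    intro a
    simp only [h, Finset.sum_add_distrib, hp]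
    simp
    ring
  simp only [h2, Finset.sum_add_distrib, ← Finset.mul_sum, hp, chiSqUniform]
  ring

lemma iidMean_collisionStat {p : A → ℝ} (hp : ∑ a, p a = 1) (n : ℕ) :
    iidMean p (collisionStat n) = (n : ℝ) ^ 2 * chiSqUniform p := by
  rw [iidMean_sumElim]
  have h1 : ∀ x : Fin n → A, iidMean p (fun y : Fin n → A => collisionStat n (Sum.elim x y)) =
      ∑ i, (n : ℝ) * (Fintype.card A * p (x i) - 1) := by
    intro x
    simp only [collisionStat, Sum.elim_inl, Sum.elim_inr, iidMean_sum]
    refine Finset.sum_congr rfl fun i _ => ?_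
    simp [iidMean_apply hp (fun b => collisionKernel (x i) b), collisionKernel_mean_right hp, mul_sub]
  simp only [h1, iidMean_sum, iidMean_mul_left,
    iidMean_apply hp (fun a => Fintype.card A * p a - 1), sum_mul_card_mul_sub_one hp]
  simp
  ring

/-- The second moment of the collision statistic: `iidMean_sum_sq` is used on one half of the
block with the other half fixed, and then on the remaining half. -/
lemma iidMean_collisionStat_sq {p : A → ℝ} (hp : ∑ a, p a = 1) (n : ℕ) :
    iidMean p (fun z => collisionStat n z ^ 2) =
      (n : ℝ) ^ 2 * ((Fintype.card A : ℝ) * (1 + chiSqUniform p) - 2 * (1 + chiSqUniform p) + 1) +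
      2 * (n : ℝ) ^ 2 * (n - 1) * ∑ a, p a * (Fintype.card A * p a - 1) ^ 2 +
      (n : ℝ) ^ 2 * (n - 1) ^ 2 * chiSqUniform p ^ 2 := by
  rw [iidMean_sumElim]
  have h1 : ∀ x : Fin n → A,
      iidMean p (fun y : Fin n → A => collisionStat n (Sum.elim x y) ^ 2) =
      n * (∑ b, p b * (∑ i, collisionKernel (x i) b) ^ 2) +
        (n * (n - 1) : ℝ) * (∑ i, (Fintype.card A * p (x i) - 1)) ^ 2 := by
    intro x
    have h := iidMean_sum_sq (ι := Fin n) hp (fun b => ∑ i, collisionKernel (x i) b)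
    simp only [Fintype.card_fin] at h
    have h3 : ∑ b, p b * ∑ i, collisionKernel (x i) b =
        ∑ i, (Fintype.card A * p (x i) - 1) := by
      simp only [Finset.mul_sum]
      rw [Finset.sum_comm]
      exact Finset.sum_congr rfl fun i _ => collisionKernel_mean_right hp (x i)
    rw [h3] at h
    rw [← h]
    unfold collisionStat
    congr 1
    funext y
    rw [Finset.sum_comm]
    rfl
  simp only [h1, iidMean_add, iidMean_mul_left, iidMean_sum]
  have h2 : ∀ b, iidMean p (fun x : Fin n → A => (∑ i, collisionKernel (x i) b) ^ 2) =
      n * (∑ a, p a * collisionKernel a b ^ 2) +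
        (n * (n - 1) : ℝ) * (Fintype.card A * p b - 1) ^ 2 := by
    intro b
    rw [iidMean_sum_sq (ι := Fin n) hp (fun a => collisionKernel a b), Fintype.card_fin,
      ← collisionKernel_mean_right hp b]
    simp only [collisionKernel_comm b]
  have h4 := iidMean_sum_sq (ι := Fin n) hp (fun a => Fintype.card A * p a - 1)
  rw [sum_mul_card_mul_sub_one hp, Fintype.card_fin] at h4
  have h5 : ∑ b, p b * (n * (∑ a, p a * collisionKernel a b ^ 2) +
        (n * (n - 1) : ℝ) * (Fintype.card A * p b - 1) ^ 2) =
      n * (∑ b, p b * (∑ a, p a * collisionKernel a b ^ 2)) +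
        (n * (n - 1) : ℝ) * ∑ b, p b * (Fintype.card A * p b - 1) ^ 2 := by
    rw [Finset.mul_sum, Finset.mul_sum, ← Finset.sum_add_distrib]
    exact Finset.sum_congr rfl fun b _ => by ring
  simp only [h2, h4, h5, collisionKernel_second_moment hp]
  ring

lemma iidMean_collisionStat_variance_le [Nonempty A] {p : A → ℝ} (hp0 : ∀ a, 0 ≤ p a)
    (hp : ∑ a, p a = 1) {n : ℕ} (hn : 1 ≤ n) :
    iidMean p (fun z => (collisionStat n z - (n : ℝ) ^ 2 * chiSqUniform p) ^ 2) ≤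
      (n : ℝ) ^ 2 * (Fintype.card A * (1 + chiSqUniform p)) +
      2 * (n : ℝ) ^ 3 * ((1 + √(Fintype.card A * chiSqUniform p)) * chiSqUniform p) := by
  have hm : (0 : ℝ) < Fintype.card A := by exact_mod_cast Fintype.card_pos
  have hX : 0 ≤ chiSqUniform p := by
    have := sum_card_mul_sub_one_sq hp
    refine nonneg_of_mul_nonneg_right (a := (Fintype.card A : ℝ)) ?_ hm
    rw [← this]
    positivity
  have h := iidMean_collisionStat_sq hp n
  have h1 := iidMean_collisionStat hp n
  have h3 : iidMean p (fun z => (collisionStat n z - (n : ℝ) ^ 2 * chiSqUniform p) ^ 2) =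
      iidMean p (fun z => collisionStat n z ^ 2) - (n : ℝ) ^ 4 * chiSqUniform p ^ 2 := by
    have : ∀ z : Fin n ⊕ Fin n → A, (collisionStat n z - (n : ℝ) ^ 2 * chiSqUniform p) ^ 2 =
        collisionStat n z ^ 2 + ((-2 * ((n : ℝ) ^ 2 * chiSqUniform p)) * collisionStat n z +
          ((n : ℝ) ^ 2 * chiSqUniform p) ^ 2) := fun z => by ring
    simp only [this]
    rw [iidMean_add, iidMean_add, iidMean_mul_left, iidMean_const hp, h1]
    ring
  rw [h3, h]
  have hn' : (1 : ℝ) ≤ n := by exact_mod_cast hn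
  have hS := sum_mul_sq_le_chiSqUniform hp
  have hS0 : 0 ≤ ∑ a, p a * (Fintype.card A * p a - 1) ^ 2 :=
    Finset.sum_nonneg fun a _ => mul_nonneg (hp0 a) (sq_nonneg _)
  set S := ∑ a, p a * (Fintype.card A * p a - 1) ^ 2
  set X := chiSqUniform p
  have e1 : 2 * (n : ℝ) ^ 2 * (n - 1) * S ≤
      2 * (n : ℝ) ^ 3 * ((1 + √(Fintype.card A * X)) * X) := by
    have : 2 * (n : ℝ) ^ 2 * (n - 1) ≤ 2 * (n : ℝ) ^ 3 := by nlinarith [sq_nonneg (n : ℝ)]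
    exact mul_le_mul this hS hS0 (by positivity)
  have e2 : (n : ℝ) ^ 2 * (n - 1) ^ 2 * X ^ 2 ≤ (n : ℝ) ^ 4 * X ^ 2 := by
    refine mul_le_mul_of_nonneg_right ?_ (sq_nonneg _)
    nlinarith [mul_nonneg (sq_nonneg (n : ℝ)) (by linarith : (0 : ℝ) ≤ 2 * n - 1)]
  have e3 : 0 ≤ (n : ℝ) ^ 2 * (1 + 2 * X) := by positivity
  linarith

/-- The numerical heart of the collision test: above `1024 √m / δ` symbols per half, the standard
deviation of the statistic is at most an eighth of its mean. -/
lemma collision_variance_bound {m X n δ : ℝ} (hm : 1 ≤ m) (h0 : 0 < δ) (h1 : δ < 1)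
    (hX : δ / 4 ≤ X) (hn : 1024 * √m / δ ≤ n) :
    n ^ 2 * (m * (1 + X)) + 2 * n ^ 3 * ((1 + √(m * X)) * X) ≤ n ^ 4 * X ^ 2 / 64 := by
  have hX0 : 0 < X := by linarith
  rw [div_le_iff₀ h0] at hn
  have hr1 : 1 ≤ √m := Real.one_le_sqrt.2 hm
  have hr2 : √m ^ 2 = m := Real.sq_sqrt (by linarith)
  have hs2 : √(m * X) ^ 2 = m * X := Real.sq_sqrt (by positivity)
  have hs0 := Real.sqrt_nonneg (m * X)
  set r := √m
  set s := √(m * X)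
  have hn0 : 0 < n := by by_contra h; nlinarith [not_lt.1 h]
  have hnr : 1024 * r ≤ n := by nlinarith
  set w := n * X with hw
  have hwr : 256 * r ≤ w := by nlinarith
  have e1 : m ≤ w ^ 2 / 65536 := by nlinarith
  have e2 : s ^ 2 ≤ (w / 512) ^ 2 := by
    have : (1024 * r) * X * (256 * r) ≤ n * X * w := by gcongr
    nlinarith
  have e3 : s ≤ w / 512 := by
    exact abs_le_of_sq_le_sq' e2 (by linarith) |>.2
  have e4 : 2 * w ≤ w ^ 2 / 128 := by nlinarith
  have e5 : 2 * w * s ≤ w ^ 2 / 256 := by nlinarith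
  have key : m * (1 + X) + 2 * w * (1 + s) ≤ w ^ 2 / 64 := by nlinarith
  calc n ^ 2 * (m * (1 + X)) + 2 * n ^ 3 * ((1 + s) * X)
      = n ^ 2 * (m * (1 + X) + 2 * w * (1 + s)) := by rw [hw]; ring
    _ ≤ n ^ 2 * (w ^ 2 / 64) := by gcongr
    _ = _ := by rw [hw]; ring

/-- The collision test as a positive function: `4` when the statistic exceeds half of the smallest
mean `n² δ / 4` possible on the family, and `1 / 4` otherwise. -/
lemma exists_collision_test [Nonempty A] {δ : ℝ} (h0 : 0 < δ) (h1 : δ < 1) {n : ℕ}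
    (hn : 1024 * √(Fintype.card A) / δ ≤ n) :
    ∃ f : (Fin n ⊕ Fin n → A) → ℝ, (∀ y, 0 < f y) ∧
      iidMean (fun _ => 1 / (Fintype.card A : ℝ)) f ≤ 1 / 2 ∧
      ∀ P ∈ renyiFamily A δ, iidMean P.1 (fun y => (f y)⁻¹) ≤ 1 / 2 := by
  have hm : (1 : ℝ) ≤ Fintype.card A := by exact_mod_cast Fintype.card_pos
  have hn0 : (0 : ℝ) < n := lt_of_lt_of_le (by positivity) hn
  have hn1 : 1 ≤ n := by exact_mod_cast hn0
  refine ⟨fun z => if (n : ℝ) ^ 2 * (δ / 8) ≤ collisionStat n z then 4 else 1 / 4,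
    fun y => by positivity, ?_, fun P hP => ?_⟩
  · have hp : ∑ _a : A, 1 / (Fintype.card A : ℝ) = 1 := by simp
    have hX : chiSqUniform (fun _ : A => 1 / (Fintype.card A : ℝ)) = 0 := by
      simp only [chiSqUniform, Finset.sum_const, Finset.card_univ, nsmul_eq_mul]
      field_simp
      ring
    have hV := iidMean_collisionStat_variance_le (fun _ => by positivity) hp hn1
    simp only [hX, mul_zero, sub_zero, add_zero, mul_one] at hV
    set c : ℝ := 4 / ((n : ℝ) ^ 2 * (δ / 8)) ^ 2 with hc
    refine le_trans (iidMean_mono (g := fun z => c * collisionStat n z ^ 2 + 1 / 4)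
      (fun _ => by positivity) fun z => ?_) ?_
    · split_ifs with h
      · have : ((n : ℝ) ^ 2 * (δ / 8)) ^ 2 ≤ collisionStat n z ^ 2 :=
          pow_le_pow_left₀ (by positivity) h 2
        have h4 : 4 ≤ c * collisionStat n z ^ 2 := by
          rw [hc, div_mul_eq_mul_div, le_div_iff₀ (by positivity)]
          linarith
        linarith
      · have : 0 ≤ c * collisionStat n z ^ 2 := by positivity
        linarith
    · rw [iidMean_add, iidMean_mul_left, iidMean_const hp]
      have : c * ((n : ℝ) ^ 2 * Fintype.card A) ≤ 1 / 4 := by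
        rw [hc, div_mul_eq_mul_div, div_le_iff₀ (by positivity)]
        rw [div_le_iff₀ h0] at hn
        have h2 : (1024 * √(Fintype.card A : ℝ)) ^ 2 ≤ (n * δ) ^ 2 :=
          pow_le_pow_left₀ (by positivity) hn 2
        rw [mul_pow, Real.sq_sqrt (by linarith)] at h2
        have h3 : (n : ℝ) ^ 2 * ((1024 : ℝ) ^ 2 * Fintype.card A) ≤ (n : ℝ) ^ 2 * (n * δ) ^ 2 := by
          gcongr
        nlinarith
      have := mul_le_mul_of_nonneg_left hV (by positivity : 0 ≤ c)
      linarith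
  · have hX := chiSqUniform_ge_of_mem h0 h1 hP
    have hV := (iidMean_collisionStat_variance_le P.2.1 P.2.2 hn1).trans
      (collision_variance_bound hm h0 h1 hX hn)
    set X := chiSqUniform P.1
    have hX0 : 0 < X := by linarith
    set c : ℝ := 16 / ((n : ℝ) ^ 2 * X) ^ 2 with hc
    refine le_trans (iidMean_mono (g := fun z => c * (collisionStat n z - (n : ℝ) ^ 2 * X) ^ 2 +
      1 / 4) P.2.1 fun z => ?_) ?_
    · simp only
      split_ifs with h
      · have : 0 ≤ c * (collisionStat n z - (n : ℝ) ^ 2 * X) ^ 2 := by positivity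
        linarith
      · have h5 : collisionStat n z < (n : ℝ) ^ 2 * X / 2 := by
          have : (n : ℝ) ^ 2 * (δ / 8) ≤ (n : ℝ) ^ 2 * (X / 2) := 
            mul_le_mul_of_nonneg_left (by linarith) (by positivity)
          linarith
        have h6 : ((n : ℝ) ^ 2 * X / 2) ^ 2 ≤ (collisionStat n z - (n : ℝ) ^ 2 * X) ^ 2 := by
          rw [← neg_sq (collisionStat n z - _)]
          refine pow_le_pow_left₀ (by positivity) ?_ 2
          linarith
        have h4 : 4 ≤ c * (collisionStat n z - (n : ℝ) ^ 2 * X) ^ 2 := by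
          rw [hc, div_mul_eq_mul_div, le_div_iff₀ (by positivity)]
          linarith
        norm_num
        linarith
    · rw [iidMean_add, iidMean_mul_left, iidMean_const P.2.2]
      have h7 := mul_le_mul_of_nonneg_left hV (by positivity : 0 ≤ c)
      have h8 : c * ((n : ℝ) ^ 4 * X ^ 2 / 64) = 1 / 4 := by
        rw [hc]
        field_simp
        norm_num
      linarith

/-- The upper bound on the sample complexity: `⌈log (1/ε)⌉` repetitions of the collision test,
each on two halves of `⌈1024 √m / δ⌉` symbols. -/
lemma flSampleComplexity_renyiFamily_le [Nonempty A] {ε δ : ℝ} (hε0 : 0 < ε) (hε1 : ε < 1)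
    (h0 : 0 < δ) (h1 : δ < 1) :
    (flSampleComplexity (renyiFamily A δ) ε : ENNReal) ≤ ENNReal.ofReal
      (73800 * (√(Fintype.card A) * (Real.logb 2 (1 / ε) + 1 / 18) / δ)) := by
  have hm : (1 : ℝ) ≤ Fintype.card A := by exact_mod_cast Fintype.card_pos
  have hr : 1 ≤ √(Fintype.card A : ℝ) := Real.one_le_sqrt.2 hm
  set r := √(Fintype.card A : ℝ)
  have hrδ : 1 ≤ r / δ := by rw [le_div_iff₀ h0]; linarith
  set L := Real.logb 2 (1 / ε) with hL
  have hL0 : 0 < L := Real.logb_pos (by norm_num) (by rw [lt_div_iff₀ hε0]; linarith)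
  set n := ⌈1024 * r / δ⌉₊ with hn
  have hn1 : 1024 * r / δ ≤ n := Nat.le_ceil _
  have hn2 : (n : ℝ) ≤ 1025 * (r / δ) := by
    have := (Nat.ceil_lt_add_one (by positivity : 0 ≤ 1024 * r / δ)).le
    rw [mul_div_assoc] at this
    rw [hn, mul_div_assoc]
    linarith
  have hnpos : 0 < n := Nat.ceil_pos.2 (by positivity)
  set k := ⌈L⌉₊ with hk
  have hk1 : L ≤ k := Nat.le_ceil _
  have hk2 : (k : ℝ) ≤ L + 1 := (Nat.ceil_lt_add_one hL0.le).le
  have hkpos : 0 < k := Nat.ceil_pos.2 hL0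
  obtain ⟨f, hf, hU, hQ⟩ := exists_collision_test (A := A) h0 h1 hn1
  have hval := bestCodebookValue_le_of_test _ f hf hU hQ k
  have hcard : Fintype.card (Fin n ⊕ Fin n) = 2 * n := by simp; ring
  rw [hcard] at hval
  have hpow : (1 / 2 : ℝ) ^ k ≤ ε := by
    have h2 : 1 / ε ≤ (2 : ℝ) ^ (k : ℝ) :=
      (Real.logb_le_iff_le_rpow (by norm_num) (by positivity)).1 hk1
    rw [Real.rpow_natCast] at h2
    rw [one_div, inv_pow, inv_le_comm₀ (by positivity) hε0]
    simpa using h2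
  have hle : flSampleComplexity (renyiFamily A δ) ε ≤ ((k * (2 * n) : ℕ) : ℕ∞) :=
    sInf_le ⟨k * (2 * n), rfl, Nat.succ_le_of_lt (by positivity), hval.trans hpow⟩
  have hle' : (flSampleComplexity (renyiFamily A δ) ε : ENNReal) ≤
      (((k * (2 * n) : ℕ) : ℕ∞) : ENNReal) := by exact_mod_cast hle
  refine hle'.trans ?_
  have hreal : ((k * (2 * n) : ℕ) : ℝ) ≤ 73800 * (r * (L + 1 / 18) / δ) := by
    push_cast
    calc (k : ℝ) * (2 * n) ≤ (36 * (L + 1 / 18)) * (2 * (1025 * (r / δ))) := by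
          gcongr; linarith
      _ = _ := by ring
  rw [ENat.toENNReal_coe, ← ENNReal.ofReal_natCast]
  exact ENNReal.ofReal_le_ofReal hreal

end Collision

/-! ### The chi-square lower bound for mixtures -/

/-- A set of `Q`-probability at least `1 - ε` and relative size at most `ε` forces the chi-square
divergence of `Q` from the uniform distribution to be at least `(1 - 2 ε)² / ε`. -/
lemma sq_le_mul_chiSq {Ω : Type*} [Fintype Ω] [Nonempty Ω] [DecidableEq Ω] {Q : Ω → ℝ}
    (hQ : ∑ x, Q x = 1) {ε : ℝ} (hε : ε < 1 / 2) {C : Finset Ω} (hC : ∑ x ∈ Cᶜ, Q x ≤ ε)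
    (hcard : (C.card : ℝ) / Fintype.card Ω ≤ ε) :
    (1 - 2 * ε) ^ 2 ≤ ε * (Fintype.card Ω * ∑ x, Q x ^ 2 - 1) := by
  have hN : (0 : ℝ) < Fintype.card Ω := by exact_mod_cast Fintype.card_pos
  set N : ℝ := (Fintype.card Ω : ℝ) with hNdef
  have hsplit := Finset.sum_add_sum_compl C Q
  have h1 : 1 - 2 * ε ≤ ∑ x ∈ C, (Q x - 1 / N) := by
    rw [Finset.sum_sub_distrib, Finset.sum_const, nsmul_eq_mul, mul_one_div]
    linarith
  have h2 : (∑ x ∈ C, (Q x - 1 / N)) ^ 2 ≤ C.card * ∑ x ∈ C, (Q x - 1 / N) ^ 2 :=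
    sq_sum_le_card_mul_sum_sq
  have h3 : ∑ x ∈ C, (Q x - 1 / N) ^ 2 ≤ ∑ x, (Q x - 1 / N) ^ 2 :=
    Finset.sum_le_sum_of_subset_of_nonneg (Finset.subset_univ C) fun _ _ _ => sq_nonneg _
  have h4 : ∑ x, (Q x - 1 / N) ^ 2 = (N * ∑ x, Q x ^ 2 - 1) / N := by
    have : ∀ x, (Q x - 1 / N) ^ 2 = Q x ^ 2 - 2 / N * Q x + 1 / N ^ 2 := fun x => by ring
    simp only [this, Finset.sum_add_distrib, Finset.sum_sub_distrib, ← Finset.mul_sum, hQ,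
      Finset.sum_const, Finset.card_univ, nsmul_eq_mul, ← hNdef]
    field_simp
    ring
  have h5 : 0 ≤ N * ∑ x, Q x ^ 2 - 1 := by
    rw [eq_div_iff hN.ne'] at h4
    exact h4 ▸ mul_nonneg (Finset.sum_nonneg fun x _ => sq_nonneg _) hN.le
  calc (1 - 2 * ε) ^ 2 ≤ (∑ x ∈ C, (Q x - 1 / N)) ^ 2 :=
        pow_le_pow_left₀ (by linarith) h1 2
    _ ≤ C.card * ((N * ∑ x, Q x ^ 2 - 1) / N) :=
        h2.trans (mul_le_mul_of_nonneg_left (h3.trans h4.le) (by positivity))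
    _ = C.card / N * (N * ∑ x, Q x ^ 2 - 1) := by ring
    _ ≤ _ := mul_le_mul_of_nonneg_right hcard h5

/-- Le Cam's method with the chi-square divergence: if a codebook performs within `ε` on every
member of a finite family `P`, then so it does on the uniform mixture of the product measures,
whose second moment is an average of powers of the correlations `m ∑ P s · P t`. -/
lemma sq_le_of_mixture {A S : Type*} [Fintype A] [Nonempty A] [DecidableEq A] [Fintype S]
    [Nonempty S] (P : S → Simplex A) {n : ℕ} {ε M : ℝ} (hε0 : 0 < ε) (hε : ε < 1 / 2)
    {C : Finset (Fin n → A)} (hC : ∀ s, blockProb (P s) Cᶜ ≤ ε)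
    (hcard : (C.card : ℝ) / (Fintype.card A : ℝ) ^ n ≤ ε)
    (hM : ∀ t, ∑ s, (Fintype.card A * ∑ a, (P s).1 a * (P t).1 a) ^ n ≤ Fintype.card S * M) :
    (1 - 2 * ε) ^ 2 ≤ ε * (M - 1) := by
  have hS : (0 : ℝ) < Fintype.card S := by exact_mod_cast Fintype.card_pos
  set K : ℝ := (Fintype.card S : ℝ) with hK
  set Q : (Fin n → A) → ℝ := fun x => (∑ s, ∏ i, (P s).1 (x i)) / K with hQdef
  have hQ : ∑ x, Q x = 1 := by
    simp only [hQdef, ← Finset.sum_div]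
    rw [Finset.sum_comm, div_eq_one_iff_eq hS.ne']
    have : ∀ s, ∑ x : Fin n → A, ∏ i, (P s).1 (x i) = 1 := fun s => by
      rw [← Fintype.sum_pow, (P s).2.2, one_pow]
    simp [this, hK]
  have hQC : ∑ x ∈ Cᶜ, Q x ≤ ε := by
    simp only [hQdef, ← Finset.sum_div]
    rw [Finset.sum_comm, div_le_iff₀ hS]
    refine (Finset.sum_le_sum fun s _ => hC s).trans ?_
    simp [hK, mul_comm]
  have hsq : (Fintype.card (Fin n → A) : ℝ) * ∑ x, Q x ^ 2 ≤ M := by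
    have h1 : (Fintype.card (Fin n → A) : ℝ) * ∑ x, Q x ^ 2 =
        (∑ t, ∑ s, (Fintype.card A * ∑ a, (P s).1 a * (P t).1 a) ^ n) / K ^ 2 := by
      have h2 : ∀ s t, (Fintype.card A * ∑ a, (P s).1 a * (P t).1 a) ^ n =
          (Fintype.card (Fin n → A) : ℝ) *
            ∑ x : Fin n → A, (∏ i, (P t).1 (x i)) * ∏ i, (P s).1 (x i) := fun s t => by
        simp [mul_pow, Fintype.sum_pow, Finset.prod_mul_distrib, mul_comm]
      simp only [hQdef, div_pow, ← Finset.sum_div, mul_div_assoc', h2, ← Finset.mul_sum]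
      congr 2
      simp only [pow_two, Finset.sum_mul_sum]
      rw [Finset.sum_comm]
      exact Finset.sum_congr rfl fun t _ => Finset.sum_comm
    rw [h1, div_le_iff₀ (by positivity)]
    refine (Finset.sum_le_sum fun t _ => hM t).trans ?_
    simp only [Finset.sum_const, Finset.card_univ, nsmul_eq_mul, ← hK]
    exact (by ring : K * (K * M) = M * K ^ 2).le
  have hcard' : (C.card : ℝ) / Fintype.card (Fin n → A) ≤ ε := by simpa using hcard
  refine (sq_le_mul_chiSq hQ hε hQC hcard').trans ?_
  gcongr

/-! ### Sources with one spike in each block -/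

section Spikes

variable {A : Type*} [Fintype A] [DecidableEq A] {k : ℕ} (p : A → Fin k)

/-- The size of the `j`-th block of the partition of the alphabet into the fibres of `p`. -/
def blockSize (j : Fin k) : ℕ := Fintype.card {x // p x = j}

/-- A choice of one symbol from each block. -/
abbrev BlockSection : Type _ := ∀ j : Fin k, {x // p x = j}

/-- The density `∑ⱼ bⱼ 1{x = s j}` relative to the uniform distribution, `bⱼ` being the block
sizes: in each block, all of its mass `bⱼ / m` is moved to the selected symbol. -/
noncomputable def spikeDensity (s : BlockSection p) (x : A) : ℝ :=
  if x = s (p x) then blockSize p (p x) else 0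

/-- The mixture of the uniform distribution, with weight `1 - γ`, and of the distribution that
puts all mass of each block on the symbol selected by `s`. -/
noncomputable def spikeWeight (γ : ℝ) (s : BlockSection p) (x : A) : ℝ :=
  (1 - γ + γ * spikeDensity p s x) / Fintype.card A

variable {p}

lemma sum_ite_section (s : BlockSection p) (f g : Fin k → ℝ) :
    ∑ x, (if x = s (p x) then f (p x) else g (p x)) =
      ∑ j, (f j + (blockSize p j - 1) * g j) := by
  rw [← Fintype.sum_fiberwise p]
  refine Finset.sum_congr rfl fun j _ => ?_
  have h : ∀ (j : Fin k) (i : {x // p x = j}),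
      (if i.1 = s (p i.1) then f (p i.1) else g (p i.1)) = g j + if i = s j then f j - g j else 0 := by
    rintro j ⟨x, rfl⟩
    by_cases hx : x = s (p x)
    · rw [if_pos hx, if_pos (Subtype.ext hx), add_sub_cancel]
    · rw [if_neg hx, if_neg fun h => hx (congrArg Subtype.val h), add_zero]
  simp only [h, Finset.sum_add_distrib]
  simp [blockSize]
  ring

omit [DecidableEq A] in
lemma sum_blockSize : ∑ j, (blockSize p j : ℝ) = Fintype.card A := by
  have h := Fintype.sum_fiberwise p (fun _ => (1 : ℝ))
  simpa [blockSize] using h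

lemma sum_spikeDensity (s : BlockSection p) :
    ∑ x, spikeDensity p s x = Fintype.card A := by
  rw [← sum_blockSize (p := p)]
  simpa [spikeDensity] using sum_ite_section s (fun j => (blockSize p j : ℝ)) (fun _ => 0)

lemma sum_spikeDensity_mul (s t : BlockSection p) :
    ∑ x, spikeDensity p s x * spikeDensity p t x =
      ∑ j, if s j = t j then (blockSize p j : ℝ) ^ 2 else 0 := by
  have h := sum_ite_section s (fun j => if s j = t j then (blockSize p j : ℝ) ^ 2 else 0)
    (fun _ => 0)
  simp only [mul_zero, add_zero] at h
  rw [← h]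
  refine Finset.sum_congr rfl fun x _ => ?_
  unfold spikeDensity
  by_cases hs : x = s (p x)
  · by_cases ht : x = t (p x)
    · have : s (p x) = t (p x) := Subtype.ext (hs.symm.trans ht)
      rw [if_pos hs, if_pos ht, if_pos hs, if_pos this, pow_two]
    · have : s (p x) ≠ t (p x) := fun h => ht (hs.trans (congrArg Subtype.val h))
      rw [if_pos hs, if_neg ht, if_pos hs, if_neg this, mul_zero]
  · rw [if_neg hs, if_neg hs, zero_mul]

/-- The spiked weights as a probability mass function. -/
noncomputable def spikePmf [Nonempty A] (γ : ℝ) (hγ0 : 0 ≤ γ) (hγ1 : γ ≤ 1)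
    (s : BlockSection p) : Simplex A :=
  ⟨spikeWeight p γ s, fun x => by
    have h1 : 0 ≤ spikeDensity p s x := by unfold spikeDensity; positivity
    have h2 : 0 ≤ 1 - γ := by linarith
    unfold spikeWeight; positivity, by
    have hm : (Fintype.card A : ℝ) ≠ 0 := by simp
    simp only [spikeWeight, ← Finset.sum_div, Finset.sum_add_distrib, ← Finset.mul_sum,
      sum_spikeDensity]
    simp only [Finset.sum_const, Finset.card_univ, nsmul_eq_mul]
    field_simp
    ring⟩

/-- The correlation of two spiked sources is a sum of one term for each block; each term has mean
zero when one of the two sections is uniformly random. -/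
lemma card_mul_sum_spikeWeight_mul [Nonempty A] (γ : ℝ) (s t : BlockSection p) :
    Fintype.card A * ∑ x, spikeWeight p γ s x * spikeWeight p γ t x =
      1 + ∑ j, γ ^ 2 * blockSize p j / Fintype.card A *
        ((if s j = t j then (blockSize p j : ℝ) else 0) - 1) := by
  have hm : (Fintype.card A : ℝ) ≠ 0 := by simp
  have h : ∀ x, spikeWeight p γ s x * spikeWeight p γ t x =
      ((1 - γ) ^ 2 + (1 - γ) * γ * spikeDensity p s x + (1 - γ) * γ * spikeDensity p t x +
        γ ^ 2 * (spikeDensity p s x * spikeDensity p t x)) / (Fintype.card A : ℝ) ^ 2 := by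
    intro x
    unfold spikeWeight
    field_simp
    ring
  have h2 : ∀ j, γ ^ 2 * blockSize p j / Fintype.card A *
        ((if s j = t j then (blockSize p j : ℝ) else 0) - 1) =
      γ ^ 2 / Fintype.card A * ((if s j = t j then (blockSize p j : ℝ) ^ 2 else 0) -
        blockSize p j) := by
    intro j
    split_ifs <;> ring
  simp only [h, h2, ← Finset.sum_div, Finset.sum_add_distrib, ← Finset.mul_sum, sum_spikeDensity,
    sum_spikeDensity_mul, Finset.sum_sub_distrib, sum_blockSize]
  simp only [Finset.sum_const, Finset.card_univ, nsmul_eq_mul]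
  field_simp
  ring

lemma sum_sqrt_spikeWeight [Nonempty A] (γ : ℝ) (s : BlockSection p) :
    ∑ x, √(spikeWeight p γ s x * (1 / Fintype.card A)) =
      (∑ j, (√(1 - γ + γ * blockSize p j) + (blockSize p j - 1) * √(1 - γ))) /
        Fintype.card A := by
  have hm : (0 : ℝ) < Fintype.card A := by exact_mod_cast Fintype.card_pos
  rw [← sum_ite_section s (fun j => √(1 - γ + γ * blockSize p j)) (fun _ => √(1 - γ)),
    Finset.sum_div]
  refine Finset.sum_congr rfl fun x _ => ?_
  rw [spikeWeight, div_mul_div_comm, mul_one, ← pow_two, Real.sqrt_div' _ (sq_nonneg _),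
    Real.sqrt_sq hm.le, spikeDensity]
  split_ifs <;> simp

/-- The moment generating function of the centred indicator of one of `b` equally likely values,
scaled to the range `[-1, b - 1]`, is that of a sub-Gaussian variable. -/
lemma sum_exp_le {β : Type*} [Fintype β] [DecidableEq β] (c : β) {τ : ℝ} (hτ : 0 ≤ τ) :
    ∑ a, Real.exp (τ * ((if a = c then (Fintype.card β : ℝ) else 0) - 1)) ≤
      Fintype.card β * Real.exp (τ ^ 2 * (Fintype.card β : ℝ) ^ 2) := by
  have hb1 : (1 : ℝ) ≤ Fintype.card β := by
    exact_mod_cast Fintype.card_pos_iff.2 ⟨c⟩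
  set b : ℝ := (Fintype.card β : ℝ) with hb
  rcases le_or_gt (τ * b) 1 with h | h
  · have hq : ∀ a : β, Real.exp (τ * ((if a = c then b else 0) - 1)) ≤
        1 - τ + τ ^ 2 + if a = c then τ * b + τ ^ 2 * ((b - 1) ^ 2 - 1) else 0 := by
      intro a
      have hx : ∀ x : ℝ, |x| ≤ 1 → Real.exp x ≤ 1 + x + x ^ 2 := fun x hx => by
        have := (abs_le.1 (Real.abs_exp_sub_one_sub_id_le hx)).2
        linarith
      split_ifs
      · refine (hx _ (abs_le.2 ⟨?_, ?_⟩)).trans (by linarith) <;> nlinarith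
      · refine (hx _ (abs_le.2 ⟨?_, ?_⟩)).trans (by linarith) <;> nlinarith
    refine (Finset.sum_le_sum fun a _ => hq a).trans ?_
    rw [Finset.sum_add_distrib, Finset.sum_ite_eq' Finset.univ c]
    simp only [Finset.sum_const, Finset.card_univ, nsmul_eq_mul, ← hb, Finset.mem_univ, if_true]
    have h1 := Real.add_one_le_exp (τ ^ 2 * b ^ 2)
    have h2 : b * (τ ^ 2 * b ^ 2 + 1) ≤ b * Real.exp (τ ^ 2 * b ^ 2) := by gcongr
    have h3 : 0 ≤ τ ^ 2 * (b * (b ^ 2 - b + 1)) :=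
      mul_nonneg (sq_nonneg _) (mul_nonneg (by linarith) (by nlinarith))
    nlinarith
  · have hq : ∀ a : β, Real.exp (τ * ((if a = c then b else 0) - 1)) ≤
        Real.exp (τ ^ 2 * b ^ 2) := by
      intro a
      refine Real.exp_le_exp.2 ?_
      have : τ * b ≤ τ ^ 2 * b ^ 2 := by nlinarith
      split_ifs <;> nlinarith
    refine (Finset.sum_le_sum fun a _ => hq a).trans ?_
    simp [hb]

omit [DecidableEq A] in
lemma card_blockSection : (Fintype.card (BlockSection p) : ℝ) = ∏ j, (blockSize p j : ℝ) := by
  simp [BlockSection, blockSize, Fintype.card_pi]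

/-- The second moment of the mixture of spiked sources, bounded without any averaging. -/
lemma sum_correlation_pow_le_linear [Nonempty A] {γ : ℝ} (hγ0 : 0 ≤ γ) (hγ1 : γ ≤ 1)
    (hb : ∀ j, blockSize p j ≤ 6) (n : ℕ) (t : BlockSection p) :
    ∑ s : BlockSection p, (Fintype.card A * ∑ x, (spikePmf γ hγ0 hγ1 s).1 x *
        (spikePmf γ hγ0 hγ1 t).1 x) ^ n ≤
      Fintype.card (BlockSection p) * Real.exp (5 * n * γ ^ 2) := by
  have hm : (0 : ℝ) < Fintype.card A := by exact_mod_cast Fintype.card_pos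
  rw [← nsmul_eq_mul, ← Finset.card_univ (α := BlockSection p), ← Finset.sum_const]
  refine Finset.sum_le_sum fun s _ => ?_
  have h0 : 0 ≤ Fintype.card A * ∑ x, (spikePmf γ hγ0 hγ1 s).1 x *
      (spikePmf γ hγ0 hγ1 t).1 x :=
    mul_nonneg hm.le (Finset.sum_nonneg fun x _ =>
      mul_nonneg ((spikePmf γ hγ0 hγ1 s).2.1 x) ((spikePmf γ hγ0 hγ1 t).2.1 x))
  have h1 : Fintype.card A * ∑ x, (spikePmf γ hγ0 hγ1 s).1 x *
      (spikePmf γ hγ0 hγ1 t).1 x ≤ Real.exp (5 * γ ^ 2) := by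
    refine le_trans ?_ (Real.add_one_le_exp _)
    rw [show (Fintype.card A : ℝ) * ∑ x, (spikePmf γ hγ0 hγ1 s).1 x *
      (spikePmf γ hγ0 hγ1 t).1 x = _ from card_mul_sum_spikeWeight_mul γ s t, add_comm]
    gcongr
    calc ∑ j, γ ^ 2 * blockSize p j / Fintype.card A *
          ((if s j = t j then (blockSize p j : ℝ) else 0) - 1)
        ≤ ∑ j, γ ^ 2 * blockSize p j / Fintype.card A * 5 := by
          refine Finset.sum_le_sum fun j _ => mul_le_mul_of_nonneg_left ?_ (by positivity)
          have : (blockSize p j : ℝ) ≤ 6 := by exact_mod_cast hb j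
          split_ifs <;> linarith
      _ = 5 * γ ^ 2 := by
          rw [← Finset.sum_mul, ← Finset.sum_div, ← Finset.mul_sum, sum_blockSize]
          field_simp
  calc _ ≤ Real.exp (5 * γ ^ 2) ^ n := pow_le_pow_left₀ h0 h1 n
    _ = _ := by rw [← Real.exp_nat_mul]; ring_nf

/-- The second moment of the mixture of spiked sources: averaging over the independent choices of
the spikes replaces the first-order term of the exponent by a second-order one. -/
lemma sum_correlation_pow_le_quadratic [Nonempty A] {γ : ℝ} (hγ0 : 0 ≤ γ) (hγ1 : γ ≤ 1)
    (hb : ∀ j, blockSize p j ≤ 6) (n : ℕ) (t : BlockSection p) :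
    ∑ s : BlockSection p, (Fintype.card A * ∑ x, (spikePmf γ hγ0 hγ1 s).1 x *
        (spikePmf γ hγ0 hγ1 t).1 x) ^ n ≤
      Fintype.card (BlockSection p) *
        Real.exp (216 * (n : ℝ) ^ 2 * γ ^ 4 / Fintype.card A) := by
  have hm : (0 : ℝ) < Fintype.card A := by exact_mod_cast Fintype.card_pos
  set τ : Fin k → ℝ := fun j => n * (γ ^ 2 * blockSize p j / Fintype.card A) with hτ
  have h1 : ∀ s : BlockSection p, (Fintype.card A * ∑ x, (spikePmf γ hγ0 hγ1 s).1 x *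
        (spikePmf γ hγ0 hγ1 t).1 x) ^ n ≤
      ∏ j, Real.exp (τ j * ((if s j = t j then (blockSize p j : ℝ) else 0) - 1)) := by
    intro s
    have h0 : 0 ≤ Fintype.card A * ∑ x, (spikePmf γ hγ0 hγ1 s).1 x *
        (spikePmf γ hγ0 hγ1 t).1 x :=
      mul_nonneg hm.le (Finset.sum_nonneg fun x _ =>
        mul_nonneg ((spikePmf γ hγ0 hγ1 s).2.1 x) ((spikePmf γ hγ0 hγ1 t).2.1 x))
    have h2 := card_mul_sum_spikeWeight_mul γ s t
    refine (pow_le_pow_left₀ h0 ((le_of_eq h2).trans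
      ((add_comm _ _).trans_le (Real.add_one_le_exp _))) n).trans ?_
    rw [← Real.exp_nat_mul, ← Real.exp_sum, Finset.mul_sum]
    simp only [hτ, mul_assoc, le_refl]
  have h3 : ∀ j, ∑ a : {x // p x = j},
      Real.exp (τ j * ((if a = t j then (blockSize p j : ℝ) else 0) - 1)) ≤
      blockSize p j * Real.exp (216 * (n : ℝ) ^ 2 * γ ^ 4 / (Fintype.card A : ℝ) ^ 2 *
        blockSize p j) := by
    intro j
    refine (sum_exp_le (t j) (τ := τ j) (by positivity)).trans ?_
    change (blockSize p j : ℝ) * Real.exp (τ j ^ 2 * (blockSize p j : ℝ) ^ 2) ≤ _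
    refine mul_le_mul_of_nonneg_left (Real.exp_le_exp.2 ?_) (by positivity)
    have h6 : (blockSize p j : ℝ) ≤ 6 := by exact_mod_cast hb j
    calc τ j ^ 2 * (blockSize p j : ℝ) ^ 2
        = (n : ℝ) ^ 2 * γ ^ 4 / (Fintype.card A : ℝ) ^ 2 *
            ((blockSize p j : ℝ) ^ 3 * blockSize p j) := by rw [hτ]; field_simp
      _ ≤ (n : ℝ) ^ 2 * γ ^ 4 / (Fintype.card A : ℝ) ^ 2 * (6 ^ 3 * blockSize p j) := by gcongr
      _ = _ := by ring
  calc _ ≤ ∑ s : BlockSection p,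
        ∏ j, Real.exp (τ j * ((if s j = t j then (blockSize p j : ℝ) else 0) - 1)) :=
        Finset.sum_le_sum fun s _ => h1 s
    _ = ∏ j, ∑ a : {x // p x = j},
          Real.exp (τ j * ((if a = t j then (blockSize p j : ℝ) else 0) - 1)) := by
        rw [Finset.prod_univ_sum, Fintype.piFinset_univ]
    _ ≤ ∏ j, (blockSize p j * Real.exp (216 * (n : ℝ) ^ 2 * γ ^ 4 / (Fintype.card A : ℝ) ^ 2 *
        blockSize p j)) :=
        Finset.prod_le_prod (fun j _ => Finset.sum_nonneg fun a _ => (Real.exp_pos _).le)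
          fun j _ => h3 j
    _ = _ := by
        rw [Finset.prod_mul_distrib, ← card_blockSection, ← Real.exp_sum, ← Finset.mul_sum,
          sum_blockSize]
        congr 2
        field_simp

end Spikes

/-- An alphabet with at least two symbols splits into blocks of at most six symbols, each having
at least three unless the whole alphabet has only two. -/
lemma exists_blocks (A : Type*) [Fintype A] [DecidableEq A] (hA : 2 ≤ Fintype.card A) :
    ∃ (k : ℕ) (p : A → Fin k), ∀ j, min 3 (Fintype.card A) ≤ blockSize p j ∧
      blockSize p j ≤ 6 := by
  set N := max 1 (Fintype.card A / 3) with hN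
  obtain ⟨P, hP, hcard⟩ := Finpartition.exists_equipartition_card_eq (Finset.univ : Finset A)
    (n := N) (by omega) (by rw [Finset.card_univ]; omega)
  refine ⟨_, fun x => P.parts.equivFin ⟨P.part x, P.part_mem.2 (Finset.mem_univ x)⟩, fun j => ?_⟩
  obtain ⟨⟨B, hB⟩, rfl⟩ := P.parts.equivFin.surjective j
  have hsize : blockSize (fun x => P.parts.equivFin ⟨P.part x, P.part_mem.2 (Finset.mem_univ x)⟩)
      (P.parts.equivFin ⟨B, hB⟩) = B.card := by
    rw [blockSize, Fintype.card_subtype]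
    congr 1
    ext x
    simp only [Finset.mem_filter, Finset.mem_univ, true_and, EmbeddingLike.apply_eq_iff_eq,
      Subtype.mk.injEq]
    exact ⟨fun h => h ▸ P.mem_part (Finset.mem_univ x), fun h => P.part_eq_of_mem hB h⟩
  have h1 := hP.average_le_card_part hB
  have h2 := hP.card_part_le_average_add_one hB
  rw [hcard, Finset.card_univ] at h1 h2
  rw [hsize]
  rcases le_or_gt 3 (Fintype.card A) with h3 | h3
  · have hN' : N = Fintype.card A / 3 := by omega
    have h4 : 3 ≤ Fintype.card A / N := by
      rw [Nat.le_div_iff_mul_le (by omega)]; omega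
    have h5 : Fintype.card A / N ≤ 5 := by
      rw [Nat.div_le_iff_le_mul_add_pred (by omega)]; omega
    omega
  · have hN' : N = 1 := by omega
    rw [hN', Nat.div_one] at h1 h2
    omega

/-- The spike height `γ` can be tuned so that the Bhattacharyya coefficient with the uniform
distribution equals `2 ^ (-δ / 2)`; then `γ` is of order `√δ`. -/
lemma exists_spike_height {ι : Type*} [Fintype ι] [Nonempty ι] {b : ι → ℝ} {δ : ℝ} (hδ : 0 < δ)
    (hb2 : ∀ j, 2 ≤ b j) (hbδ : ∀ j, (2 : ℝ) ^ δ ≤ b j) :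
    ∃ γ : ℝ, 0 ≤ γ ∧ γ ≤ 1 ∧ γ ^ 2 ≤ 8 * δ ∧
      ∑ j, (√(1 - γ + γ * b j) + (b j - 1) * √(1 - γ)) = (2 : ℝ) ^ (-δ / 2) * ∑ j, b j := by
  have hcont : ContinuousOn
      (fun γ : ℝ => ∑ j, (√(1 - γ + γ * b j) + (b j - 1) * √(1 - γ))) (Set.Icc 0 1) := by
    fun_prop
  have hS : 0 < ∑ j, b j := Finset.sum_pos (fun j _ => by linarith [hb2 j]) Finset.univ_nonempty
  have hle1 : (2 : ℝ) ^ (-δ / 2) ≤ 1 :=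
    Real.rpow_le_one_of_one_le_of_nonpos (by norm_num) (by linarith)
  obtain ⟨γ, ⟨h0, h1⟩, hγ⟩ := intermediate_value_Icc' (zero_le_one) hcont
    (show (2 : ℝ) ^ (-δ / 2) * ∑ j, b j ∈ _ by
      constructor
      · rw [Finset.mul_sum]
        refine Finset.sum_le_sum fun j _ => ?_
        have hsq : √(b j) ^ 2 = b j := Real.sq_sqrt (by linarith [hb2 j])
        have h3 : (2 : ℝ) ^ (δ / 2) ≤ √(b j) := by
          refine Real.le_sqrt_of_sq_le ?_
          rw [← Real.rpow_natCast, ← Real.rpow_mul (by norm_num)]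
          simpa using hbδ j
        have h4 : (2 : ℝ) ^ (-δ / 2) * (2 : ℝ) ^ (δ / 2) = 1 := by
          rw [← Real.rpow_add (by norm_num)]
          ring_nf
          simp
        have h5 : (2 : ℝ) ^ (-δ / 2) * 2 ^ (δ / 2) * √(b j) ≤ (2 : ℝ) ^ (-δ / 2) * b j := by
          rw [mul_assoc]
          refine mul_le_mul_of_nonneg_left ?_ (by positivity)
          nlinarith [Real.sqrt_nonneg (b j)]
        simpa [h4] using h5
      · simpa using mul_le_of_le_one_left hS.le hle1)
  refine ⟨γ, h0, h1, ?_, hγ⟩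
  have hterm : ∀ j, √(1 - γ + γ * b j) + (b j - 1) * √(1 - γ) ≤ (1 - γ ^ 2 / 16) * b j := by
    intro j
    have hb := hb2 j
    have hs : √(1 - γ + γ * b j) ^ 2 = 1 - γ + γ * b j := Real.sq_sqrt (by nlinarith)
    have hw : √(1 - γ) ^ 2 = 1 - γ := Real.sq_sqrt (by linarith)
    have hw1 : √(1 - γ) ≤ 1 - γ / 2 := by
      rw [Real.sqrt_le_left (by linarith)]
      nlinarith
    set s := √(1 - γ + γ * b j)
    set w := √(1 - γ)
    have h2 : (γ / 2) ^ 2 ≤ (1 - w) ^ 2 := pow_le_pow_left₀ (by linarith) (by linarith) 2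
    -- this bounds below `b - s - (b - 1) w = ((s - 1)² + (b - 1) (w - 1)²) / 2`
    have h3 : (b j - 1) * (γ / 2) ^ 2 ≤ (b j - 1) * (1 - w) ^ 2 :=
      mul_le_mul_of_nonneg_left h2 (by linarith)
    nlinarith [sq_nonneg (s - 1), mul_nonneg (sq_nonneg γ) (by linarith : 0 ≤ b j - 2)]
  have hsum := Finset.sum_le_sum fun j (_ : j ∈ Finset.univ) => hterm j
  rw [← Finset.mul_sum] at hsum
  have h5 := le_of_mul_le_mul_right (hγ.symm.le.trans hsum) hS
  have h6 : 1 - δ / 2 ≤ (2 : ℝ) ^ (-δ / 2) := by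
    rw [Real.rpow_def_of_pos (by norm_num)]
    refine le_trans ?_ (Real.add_one_le_exp _)
    nlinarith [Real.log_two_lt_d9]
  linarith

/-! ### The lower bound on the sample complexity -/

/-- A chi-square divergence `exp E - 1` compatible with errors at most `ε ≤ ε₀ < 1/2` has `E` at
least of order `log (1/ε)`, uniformly up to `ε₀`. -/
lemma mul_log_le_of_sq_le {ε ε₀ E : ℝ} (hε0 : 0 < ε) (hε : ε ≤ ε₀) (hε₀ : ε₀ < 1 / 2)
    (h : (1 - 2 * ε) ^ 2 ≤ ε * (Real.exp E - 1)) :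
    (1 - 2 * ε₀) ^ 2 / 4 * Real.log (1 / ε) ≤ E := by
  by_contra! hlt
  set c := (1 - 2 * ε₀) ^ 2 / 4 with hc
  set l := Real.log (1 / ε) with hl
  have hl0 : 0 ≤ l := Real.log_nonneg (by rw [le_div_iff₀ hε0]; linarith)
  have hc0 : 0 < c := by
    have : 0 < 1 - 2 * ε₀ := by linarith
    positivity
  have hc1 : c ≤ 1 / 2 := by rw [hc]; nlinarith
  have hεl : ε = Real.exp (-l) := by rw [hl, one_div, Real.log_inv, neg_neg, Real.exp_log hε0]
  have h1 : Real.exp E - 1 ≤ c * l * Real.exp (l / 2) := by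
    have h2 : Real.exp E ≤ Real.exp (c * l) := Real.exp_le_exp.2 hlt.le
    -- `exp y - 1 ≤ y * exp y`
    have h3 := Real.add_one_le_exp (-(c * l))
    have h4 : Real.exp (-(c * l)) * Real.exp (c * l) = 1 := by rw [← Real.exp_add]; simp
    have h5 : Real.exp (c * l) - 1 ≤ c * l * Real.exp (c * l) := by
      nlinarith [Real.exp_pos (c * l)]
    have h6 : c * l * Real.exp (c * l) ≤ c * l * Real.exp (l / 2) := by
      have : c * l ≤ l / 2 := by nlinarith
      gcongr
    linarith
  have h2 : ε * (c * l * Real.exp (l / 2)) ≤ 2 * c := by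
    have h3 : l / 2 ≤ Real.exp (l / 2) := by linarith [Real.add_one_le_exp (l / 2)]
    have h4 : ε * (Real.exp (l / 2) * Real.exp (l / 2)) = 1 := by
      rw [hεl, ← Real.exp_add, ← Real.exp_add]; ring_nf; simp
    calc ε * (c * l * Real.exp (l / 2))
        = 2 * c * (ε * (l / 2 * Real.exp (l / 2))) := by ring
      _ ≤ 2 * c * (ε * (Real.exp (l / 2) * Real.exp (l / 2))) := by gcongr
      _ = 2 * c := by rw [h4, mul_one]
  have h3 : (1 - 2 * ε₀) ^ 2 ≤ (1 - 2 * ε) ^ 2 :=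
    pow_le_pow_left₀ (by linarith) (by linarith) 2
  have h4 := mul_le_mul_of_nonneg_left h1 hε0.le
  linarith

lemma blockProb_le_one {A : Type*} [Fintype A] [DecidableEq A] (P : Simplex A) {n : ℕ}
    (C : Finset (Fin n → A)) : blockProb P C ≤ 1 := by
  rw [blockProb_eq_iidMean]
  refine (iidMean_mono (g := fun _ => 1) P.2.1 fun x => ?_).trans (iidMean_const P.2.2 1).le
  split_ifs <;> norm_num

/-- The infimum over codebooks is attained, and the supremum over the family is a bound for each
of its members. -/
lemma exists_codebook_of_bestCodebookValue_le {A : Type*} [Fintype A] [DecidableEq A]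
    {Q : Set (Simplex A)} {n : ℕ} {ε : ℝ} (h : bestCodebookValue Q n ≤ ε) :
    ∃ C : Finset (Fin n → A), (∀ P ∈ Q, blockProb P Cᶜ ≤ ε) ∧
      (C.card : ℝ) / (Fintype.card A : ℝ) ^ n ≤ ε := by
  obtain ⟨C, hC⟩ := exists_eq_ciInf_of_finite (f := fun C : Finset (Fin n → A) =>
    max (⨆ P : Q, blockProb P.1 Cᶜ) ((C.card : ℝ) / (Fintype.card A : ℝ) ^ n))
  have hmax := hC.le.trans h
  refine ⟨C, fun P hP => ?_, (le_max_right _ _).trans hmax⟩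
  have hbdd : BddAbove (Set.range fun P : Q => blockProb P.1 Cᶜ) :=
    ⟨1, by rintro _ ⟨P, rfl⟩; exact blockProb_le_one _ _⟩
  exact (le_ciSup hbdd ⟨P, hP⟩).trans ((le_max_left _ _).trans hmax)

/-- Both lower bounds on the blocklength, from the two bounds on the second moment of the mixture
of spiked sources. -/
lemma blocklength_lower_bounds {A : Type*} [Fintype A] [Nonempty A] [DecidableEq A]
    {ε ε₀ δ : ℝ} {n : ℕ} (hε0 : 0 < ε) (hε : ε ≤ ε₀) (hε₀ : ε₀ < 1 / 2) (hδ0 : 0 < δ)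
    (hδe : δ < Real.logb 2 (Real.exp 1)) (hδm : δ < Real.logb 2 (Fintype.card A))
    (hn : bestCodebookValue (renyiFamily A δ) n ≤ ε) :
    (1 - 2 * ε₀) ^ 2 / 4 * Real.log (1 / ε) ≤ 40 * n * δ ∧
      (1 - 2 * ε₀) ^ 2 / 4 * Real.log (1 / ε) * Fintype.card A ≤ 13824 * (n * δ) ^ 2 := by
  obtain ⟨C, hC, hcard⟩ := exists_codebook_of_bestCodebookValue_le hn
  have hm : (0 : ℝ) < Fintype.card A := by exact_mod_cast Fintype.card_pos
  have h2e : (2 : ℝ) ^ δ ≤ 3 :=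
    ((Real.lt_logb_iff_rpow_lt (by norm_num) (Real.exp_pos 1)).1 hδe).le.trans
      Real.exp_one_lt_three.le
  have h2m : (2 : ℝ) ^ δ < Fintype.card A :=
    (Real.lt_logb_iff_rpow_lt (by norm_num) hm).1 hδm
  have hA : 2 ≤ Fintype.card A := by
    have h1 : (1 : ℝ) ≤ 2 ^ δ := Real.one_le_rpow (by norm_num) hδ0.le
    exact_mod_cast h1.trans_lt h2m
  obtain ⟨k, p, hp⟩ := exists_blocks A hA
  have : Nonempty (Fin k) := ⟨p (Classical.arbitrary A)⟩
  have hb6 : ∀ j, blockSize p j ≤ 6 := fun j => (hp j).2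
  have hb2 : ∀ j, (2 : ℝ) ≤ blockSize p j := fun j => by
    have := (hp j).1
    exact_mod_cast (show 2 ≤ blockSize p j by omega)
  have hbδ : ∀ j, (2 : ℝ) ^ δ ≤ blockSize p j := fun j => by
    rcases min_le_iff.1 (hp j).1 with h | h
    · exact h2e.trans (by exact_mod_cast h)
    · exact h2m.le.trans (by exact_mod_cast h)
  obtain ⟨γ, hγ0, hγ1, hγδ, hγ⟩ := exists_spike_height hδ0 hb2 hbδ
  rw [sum_blockSize] at hγ
  have : Nonempty (BlockSection p) := by
    refine ⟨fun j => Classical.choice (Fintype.card_pos_iff.1 ?_)⟩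
    have := (hp j).1
    change 0 < blockSize p j
    omega
  have hmem : ∀ s : BlockSection p, spikePmf γ hγ0 hγ1 s ∈ renyiFamily A δ := by
    intro s
    have hB : ∑ x, √((spikePmf γ hγ0 hγ1 s).1 x * (uniformPmf A).1 x) = (2 : ℝ) ^ (-δ / 2) := by
      refine (sum_sqrt_spikeWeight γ s).trans ?_
      rw [hγ, mul_div_assoc, div_self hm.ne', mul_one]
    change δ ≤ -2 * Real.logb 2 _
    rw [hB, Real.logb_rpow (by norm_num) (by norm_num)]
    linarith
  have hCs : ∀ s : BlockSection p, blockProb (spikePmf γ hγ0 hγ1 s) Cᶜ ≤ ε :=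
    fun s => hC _ (hmem s)
  have hε2 : ε < 1 / 2 := by linarith
  have h1 := mul_log_le_of_sq_le hε0 hε hε₀ (sq_le_of_mixture _ hε0 hε2 hCs hcard
    (sum_correlation_pow_le_linear hγ0 hγ1 hb6 n))
  have h2 := mul_log_le_of_sq_le hε0 hε hε₀ (sq_le_of_mixture _ hε0 hε2 hCs hcard
    (sum_correlation_pow_le_quadratic hγ0 hγ1 hb6 n))
  constructor
  · refine h1.trans ?_
    calc 5 * n * γ ^ 2 ≤ 5 * n * (8 * δ) := by gcongr
      _ = 40 * n * δ := by ring
  · rw [le_div_iff₀ hm] at h2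
    refine h2.trans ?_
    calc 216 * (n : ℝ) ^ 2 * γ ^ 4 = 216 * (n : ℝ) ^ 2 * (γ ^ 2) ^ 2 := by ring
      _ ≤ 216 * (n : ℝ) ^ 2 * (8 * δ) ^ 2 := by gcongr
      _ = 13824 * (n * δ) ^ 2 := by ring

lemma le_flSampleComplexity_renyiFamily {A : Type*} [Fintype A] [Nonempty A] [DecidableEq A]
    {ε ε₀ δ : ℝ} (hε0 : 0 < ε) (hε : ε ≤ ε₀) (hε₀ : ε₀ < 1 / 2) (hδ0 : 0 < δ)
    (hδe : δ < Real.logb 2 (Real.exp 1)) (hδm : δ < Real.logb 2 (Fintype.card A)) :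
    ENNReal.ofReal ((1 - 2 * ε₀) ^ 2 / 4000 * ((Real.logb 2 (1 / ε) +
        √((Fintype.card A : ℝ) * Real.logb 2 (1 / ε))) / δ)) ≤
      (flSampleComplexity (renyiFamily A δ) ε : ENNReal) := by
  by_cases h : flSampleComplexity (renyiFamily A δ) ε = ⊤
  · simp [h]
  have hne : {N : ℕ∞ | ∃ n : ℕ, N = n ∧ 1 ≤ n ∧
      bestCodebookValue (renyiFamily A δ) n ≤ ε}.Nonempty := by
    by_contra hempty
    rw [Set.not_nonempty_iff_eq_empty] at hempty
    exact h (by rw [flSampleComplexity, hempty, sInf_empty])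
  obtain ⟨n, hn, -, hval⟩ := csInf_mem hne
  obtain ⟨h1, h2⟩ := blocklength_lower_bounds hε0 hε hε₀ hδ0 hδe hδm hval
  rw [flSampleComplexity, hn, ENat.toENNReal_coe, ← ENNReal.ofReal_natCast]
  refine ENNReal.ofReal_le_ofReal ?_
  set l := Real.log (1 / ε) with hl
  have hl0 : 0 ≤ l := Real.log_nonneg (by rw [le_div_iff₀ hε0]; linarith)
  set c := (1 - 2 * ε₀) ^ 2 / 4 with hc
  have hc0 : 0 ≤ c := by positivity
  have hc1 : c ≤ 1 := by rw [hc]; nlinarith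
  have hL0 : 0 ≤ Real.logb 2 (1 / ε) :=
    Real.logb_nonneg (by norm_num) (by rw [le_div_iff₀ hε0]; linarith)
  have hL : Real.logb 2 (1 / ε) ≤ 2 * l := by
    rw [Real.logb, ← hl, div_le_iff₀ (by linarith [Real.log_two_gt_d9])]
    nlinarith [Real.log_two_gt_d9]
  set m : ℝ := (Fintype.card A : ℝ) with hm
  have hm0 : 0 ≤ m := by positivity
  have hnδ : 0 ≤ n * δ := by positivity
  have h3 : c * √(m * Real.logb 2 (1 / ε)) ≤ 200 * (n * δ) := by
    rw [← Real.sqrt_sq hc0, ← Real.sqrt_mul (sq_nonneg c)]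
    refine Real.sqrt_le_iff.2 ⟨by positivity, ?_⟩
    calc c ^ 2 * (m * Real.logb 2 (1 / ε)) ≤ c * 1 * (m * (2 * l)) := by
          rw [pow_two]
          gcongr
      _ = 2 * (c * l * m) := by ring
      _ ≤ (200 * (n * δ)) ^ 2 := by nlinarith [sq_nonneg (n * δ)]
  have h4 : c * Real.logb 2 (1 / ε) ≤ 80 * (n * δ) := by
    have := mul_le_mul_of_nonneg_left hL hc0
    linarith
  rw [show (1 - 2 * ε₀) ^ 2 / 4000 = c / 1000 by rw [hc]; ring, ← mul_div_assoc,
    div_le_iff₀ hδ0]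
  linarith

theorem theorem9 :
    (∀ ε₀ : ℝ, ε₀ < 1 / 2 →
      ∃ C₁ : ℝ, 0 < C₁ ∧
        ∀ (A : Type*) [Fintype A] [Nonempty A] [DecidableEq A] (ε δ : ℝ),
          0 < ε → ε ≤ ε₀ →
          0 < δ → δ < Real.logb 2 (Real.exp 1) → δ < Real.logb 2 (Fintype.card A) →
          ENNReal.ofReal
              (C₁ * ((Real.logb 2 (1 / ε) +
                Real.sqrt ((Fintype.card A : ℝ) * Real.logb 2 (1 / ε))) / δ))
            ≤ (flSampleComplexity (renyiFamily A δ) ε : ENNReal)) ∧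
    (∃ C₂ : ℝ, 0 < C₂ ∧
      ∀ (A : Type*) [Fintype A] [Nonempty A] [DecidableEq A] (ε δ : ℝ),
        0 < ε → ε < 1 →
        0 < δ → δ < 1 →
        (flSampleComplexity (renyiFamily A δ) ε : ENNReal) ≤
          ENNReal.ofReal
            (C₂ * (Real.sqrt (Fintype.card A) * (Real.logb 2 (1 / ε) + 1 / 18) / δ))) := by
  refine ⟨fun ε₀ hε₀ => ⟨(1 - 2 * ε₀) ^ 2 / 4000, ?_, ?_⟩, 73800, by norm_num, ?_⟩
  · have : 0 < 1 - 2 * ε₀ := by linarith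
    positivity
  · intro A _ _ _ ε δ hε0 hε hδ0 hδe hδm
    exact le_flSampleComplexity_renyiFamily hε0 hε hε₀ hδ0 hδe hδm
  · intro A _ _ _ ε δ hε0 hε1 hδ0 hδ1
    exact flSampleComplexity_renyiFamily_le hε0 hε1 hδ0 hδ1
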